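/- Let $d\in\mathbb{N}$, let $(X_{\mathbf n})_{\mathbf n\in\mathbb{N}_0^d}$ be independent, identically distributed real random variables on a probability space which are nondeterministic (there is no constant $K$ with $\mathbb{P}(X_{\mathbf n}=K)=1$ for all $\mathbf n$), and let $(\psi_{\mathbf n})_{\mathbf n\in\mathbb{N}_0^d}$ be real coefficients. Suppose that the $X_{\mathbf n}$ are either all symmetric ($X_{\mathbf n}$ and $-X_{\mathbf n}$ have the same distribution) or all positive (it suffices that $X_{\mathbf n}\ge 0$ almost surely). Suppose further that the multiple series $\sum_{\mathbf n\in\mathbb{N}_0^d}\psi_{\mathbf n}X_{\mathbf n}$ converges almost surely in the rectangular sense, that is, almost surely the limits $$\lim_{k\to\infty}\ \sum_{n_1=0}^{N_{1k}}\cdots\sum_{n_d=0}^{N_{dk}}\psi_{\mathbf n}X_{\mathbf n},$$ for all sequences $(N_{1k},\ldots,N_{dk})_{k\in\mathbb{N}}\subset\mathbb{N}_0^d$ with $\min(N_{1k},\ldots,N_{dk})\to\infty$ as $k\to\infty$, exist in $\mathbb{R}$ and coincide. Then $$\sum_{\mathbf n\in\mathbb{N}_0^d}\psi_{\mathbf n}^2<\infty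 .$$ -/

import Mathlib

open MeasureTheory ProbabilityTheory Filter

/-- The multiple series `∑ Z_k` over `k ∈ ℕ₀^d` converges almost surely in the rectangular sense:
almost surely, the sums over the boxes `{0,…,N₁} × ⋯ × {0,…,N_d}` have a (finite) limit along
every sequence of boxes all of whose side lengths (equivalently, whose minimal side length) tend
to infinity, and these limits coincide. -/
def ConvergesRectangularlyAS {Ω : Type*} [MeasurableSpace Ω] (μ : Measure Ω) {d : ℕ}
    (Z : (Fin d → ℕ) → Ω → ℝ) : Prop :=
  ∀ᵐ ω ∂μ, ∃ s : ℝ, ∀ N : ℕ → Fin d → ℕ,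
    (∀ i, Tendsto (fun k => N k i) atTop atTop) →
      Tendsto (fun k => ∑ n ∈ Finset.Iic (N k), Z n ω) atTop (nhds s)

/-- A real random field is deterministic if all its members are almost surely equal to one and the
same constant. -/
def IsDeterministicField {Ω ι : Type*} [MeasurableSpace Ω] (μ : Measure Ω)
    (Z : ι → Ω → ℝ) : Prop :=
  ∃ K : ℝ, ∀ t, ∀ᵐ ω ∂μ, Z t ω = K

/-- A real random variable is symmetric if `X` and `-X` have the same distribution. -/
def IsSymmetricRV {Ω : Type*} [MeasurableSpace Ω] (μ : Measure Ω) (X : Ω → ℝ) : Prop :=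
  IdentDistrib X (fun ω => -X ω) μ μ

/-! Along growing cubes the partial sums converge almost surely, so near `0` the moduli of their
characteristic functions are eventually at least `1/2`. By independence these factor over the law
`ν` of one variable; squaring replaces `ν` by its symmetrization and gives a bound on `∑ (1 -
|charFun ν (t * ψ i)|²)` uniform in small `t` and in finite index sets. Averaging over `t` leaves
only finitely many large weights; for the others each term is at least a constant times `ψ i ^ 2`.
-/

/-- Near the origin, the characteristic function of a law not concentrated at `0` differs from `1`
by at least a quadratic amount. -/
lemma exists_mul_sq_le_norm_one_sub_charFun (ν : Measure ℝ) [IsProbabilityMeasure ν] {a : ℝ}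
    (ha : 0 < a) (hν : 0 < ν.real {x | a ≤ |x| ∧ |x| ≤ a⁻¹}) :
    ∃ c > 0, ∀ u : ℝ, |u| ≤ a → c * u ^ 2 ≤ ‖1 - charFun ν u‖ := by
  set A : Set ℝ := {x | a ≤ |x| ∧ |x| ≤ a⁻¹} with hA
  have hAm : MeasurableSet A := by
    apply MeasurableSet.inter
    · exact measurableSet_le measurable_const measurable_id.abs
    · exact measurableSet_le measurable_id.abs measurable_const
  refine ⟨2 / Real.pi ^ 2 * a ^ 2 * ν.real A, by positivity, fun u hu => ?_⟩
  have hexp : Integrable (fun x : ℝ => Complex.exp (u * x * Complex.I)) ν := by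
    refine (integrable_const (1 : ℝ)).mono (by fun_prop) (ae_of_all _ fun x => ?_)
    rw [← Complex.ofReal_mul, Complex.norm_exp_ofReal_mul_I]
    simp
  have hcos : Integrable (fun x => Real.cos (u * x)) ν := by
    refine (integrable_const (1 : ℝ)).mono (by fun_prop) (ae_of_all _ fun x => ?_)
    simpa using Real.abs_cos_le_one (u * x)
  have hre : (charFun ν u).re = ∫ x, Real.cos (u * x) ∂ν := by
    rw [charFun_apply_real, ← RCLike.re_eq_complex_re, ← integral_re hexp]
    refine integral_congr_ae (ae_of_all _ fun x => ?_)
    simp only [RCLike.re_eq_complex_re]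
    rw [← Complex.ofReal_mul, Complex.exp_ofReal_mul_I_re]
  calc 2 / Real.pi ^ 2 * a ^ 2 * ν.real A * u ^ 2
      = ∫ x, A.indicator (fun _ => 2 / Real.pi ^ 2 * a ^ 2 * u ^ 2) x ∂ν := by
        rw [integral_indicator hAm, setIntegral_const, smul_eq_mul]; ring
    _ ≤ ∫ x, (1 - Real.cos (u * x)) ∂ν := by
        refine integral_mono ((integrable_const _).indicator hAm)
          ((integrable_const _).sub hcos) fun x => ?_
        by_cases hx : x ∈ A
        · rw [Set.indicator_of_mem hx]
          have h1 : |u * x| ≤ Real.pi := by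
            rw [abs_mul]
            calc |u| * |x| ≤ a * a⁻¹ := mul_le_mul hu hx.2 (abs_nonneg _) ha.le
              _ = 1 := mul_inv_cancel₀ ha.ne'
              _ ≤ Real.pi := by linarith [Real.pi_gt_three]
          have h2 := Real.cos_le_one_sub_mul_cos_sq h1
          have h3 : a ^ 2 ≤ x ^ 2 := by
            rw [← sq_abs x]; exact pow_le_pow_left₀ ha.le hx.1 2
          have h4 : 2 / Real.pi ^ 2 * u ^ 2 * a ^ 2 ≤ 2 / Real.pi ^ 2 * u ^ 2 * x ^ 2 := by gcongr
          dsimp only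
          nlinarith
        · rw [Set.indicator_of_notMem hx]
          linarith [Real.cos_le_one (u * x)]
    _ = (1 - charFun ν u).re := by
        rw [integral_sub (integrable_const _) hcos]; simp [hre]
    _ ≤ ‖1 - charFun ν u‖ := Complex.re_le_norm _

/-- A real law not concentrated at `0` charges some annulus around `0`. -/
lemma exists_measureReal_annulus_pos (ν : Measure ℝ) [IsProbabilityMeasure ν]
    (hν : ¬ ∀ᵐ x ∂ν, x = 0) : ∃ a > 0, 0 < ν.real {x | a ≤ |x| ∧ |x| ≤ a⁻¹} := by
  by_contra! h
  refine hν ?_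
  have h0 : ∀ n : ℕ, ∀ᵐ x ∂ν, ¬ ((n + 1 : ℝ)⁻¹ ≤ |x| ∧ |x| ≤ ((n + 1 : ℝ)⁻¹)⁻¹) := fun n => by
    have := le_antisymm (h (n + 1 : ℝ)⁻¹ (by positivity)) measureReal_nonneg
    rw [measureReal_eq_zero_iff] at this
    simpa [ae_iff] using this
  filter_upwards [ae_all_iff.2 h0] with x hx
  by_contra hx0
  obtain ⟨n, hn⟩ := exists_nat_ge (max |x| |x|⁻¹)
  refine hx n ⟨?_, ?_⟩
  · refine inv_le_of_inv_le₀ (abs_pos.2 hx0) ?_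
    linarith [(le_max_right |x| |x|⁻¹).trans hn]
  · rw [inv_inv]
    linarith [(le_max_left |x| |x|⁻¹).trans hn]

/-- A single `t` cannot exclude large weights: for a lattice law `charFun ν (t * ψ i)` may equal
`1`. Averaging over `|t| ≤ δ` bounds a tail probability instead, and each large weight pushes the
annulus mass `p` into that tail. -/
lemma finite_setOf_lt_abs_of_sum_norm_one_sub_charFun_le {ι : Type*} (ν : Measure ℝ)
    [IsProbabilityMeasure ν] {a : ℝ} (ha : 0 < a) (hν : 0 < ν.real {x | a ≤ |x| ∧ |x| ≤ a⁻¹})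
    (ψ : ι → ℝ) {δ C : ℝ} (hδ : 0 < δ)
    (hC : ∀ t : ℝ, |t| ≤ δ → ∀ s : Finset ι, ∑ i ∈ s, ‖1 - charFun ν (t * ψ i)‖ ≤ C) :
    {i | 2 / δ / a < |ψ i|}.Finite := by
  set p := ν.real {x | a ≤ |x| ∧ |x| ≤ a⁻¹} with hp
  -- Makes the interval `[-2/r, 2/r]` of the tail estimate equal to `[-δ, δ]`.
  set r := 2 / δ with hr
  have hr0 : 0 < r := by positivity
  have hrδ : 2 * r⁻¹ = δ := by rw [hr]; field_simp
  have hint : ∀ i, IntervalIntegrable (fun t => ‖1 - charFun ν (t * ψ i)‖) volume (-δ) δ := by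
    intro i
    have h := (intervalIntegrable_const (c := (1 : ℂ))).sub
      (intervalIntegrable_charFun (μ := ν.map (ψ i * ·)) (a := -δ) (b := δ))
    simp only [charFun_map_mul] at h
    simp only [mul_comm (ψ i)] at h
    exact h.norm
  have htail : ∀ i, r / a < |ψ i| →
      p ≤ 2⁻¹ * r * ∫ t in (-δ)..δ, ‖1 - charFun ν (t * ψ i)‖ := by
    intro i hi
    have : IsProbabilityMeasure (ν.map (ψ i * ·)) :=
      Measure.isProbabilityMeasure_map (by fun_prop)
    calc p ≤ (ν.map (ψ i * ·)).real {x | r < |x|} := by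
          have hm : MeasurableSet {x : ℝ | r < |x|} :=
            measurableSet_lt measurable_const measurable_id.abs
          rw [map_measureReal_apply (by fun_prop) hm]
          refine measureReal_mono (fun x hx => ?_)
          simp only [Set.mem_preimage, Set.mem_ofPred_eq, abs_mul]
          calc r = r / a * a := by field_simp
            _ < |ψ i| * a := by gcongr
            _ ≤ |ψ i| * |x| := by gcongr; exact hx.1
      _ ≤ 2⁻¹ * r * ‖∫ t in (-2 * r⁻¹)..(2 * r⁻¹), 1 - charFun (ν.map (ψ i * ·)) t‖ :=
          measureReal_abs_gt_le_integral_charFun hr0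
      _ ≤ _ := by
          rw [neg_mul, hrδ]
          gcongr
          simp only [charFun_map_mul]
          simp only [mul_comm (ψ i)]
          exact intervalIntegral.norm_integral_le_integral_norm (neg_le_self hδ.le)
  by_contra hinf
  obtain ⟨n, hn⟩ := exists_nat_gt (2⁻¹ * r * (C * (2 * δ)) / p)
  obtain ⟨s, hs, hcard⟩ := Set.Infinite.exists_subset_card_eq hinf n
  have h1 : (n : ℝ) * p ≤ 2⁻¹ * r * (C * (2 * δ)) := by
    calc (n : ℝ) * p = ∑ i ∈ s, p := by simp [hcard]
      _ ≤ ∑ i ∈ s, 2⁻¹ * r * ∫ t in (-δ)..δ, ‖1 - charFun ν (t * ψ i)‖ :=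
          Finset.sum_le_sum fun i hi => htail i (hs hi)
      _ = 2⁻¹ * r * ∫ t in (-δ)..δ, ∑ i ∈ s, ‖1 - charFun ν (t * ψ i)‖ := by
          rw [intervalIntegral.integral_finsetSum fun i _ => hint i, Finset.mul_sum]
      _ ≤ 2⁻¹ * r * ∫ t in (-δ)..δ, C := by
          gcongr
          refine intervalIntegral.integral_mono_on (by linarith)
            (by simpa [Finset.sum_fn] using IntervalIntegrable.sum s fun i _ => hint i) (by simp) fun t ht => ?_
          exact hC t (abs_le.2 ht) s
      _ = 2⁻¹ * r * (C * (2 * δ)) := by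
          rw [intervalIntegral.integral_const, smul_eq_mul]; ring
  rw [div_lt_iff₀ hν] at hn
  linarith

lemma summable_sq_of_sum_norm_one_sub_charFun_le {ι : Type*} (ν : Measure ℝ)
    [IsProbabilityMeasure ν] (hν : ¬ ∀ᵐ x ∂ν, x = 0) (ψ : ι → ℝ) {δ C : ℝ} (hδ : 0 < δ)
    (hC : ∀ t : ℝ, |t| ≤ δ → ∀ s : Finset ι, ∑ i ∈ s, ‖1 - charFun ν (t * ψ i)‖ ≤ C) :
    Summable fun i => ψ i ^ 2 := by
  obtain ⟨a, ha, hpos⟩ := exists_measureReal_annulus_pos ν hν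
  obtain ⟨c, hc, hquad⟩ := exists_mul_sq_le_norm_one_sub_charFun ν ha hpos
  have hfin := finite_setOf_lt_abs_of_sum_norm_one_sub_charFun_le ν ha hpos ψ hδ hC
  set M := 2 / δ / a with hM
  have hM0 : 0 < M := by positivity
  -- Small enough for `hC`, and for `|t * ψ i| ≤ a` whenever `|ψ i| ≤ M`.
  set t := min δ (a / M) with ht
  have ht0 : 0 < t := by positivity
  have hsum : Summable fun i => ‖1 - charFun ν (t * ψ i)‖ :=
    summable_of_sum_le (fun _ => norm_nonneg _)
      (hC t (by rw [abs_of_pos ht0]; exact min_le_left _ _))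
  refine Summable.of_norm_bounded_eventually (hsum.mul_left (c * t ^ 2)⁻¹) ?_
  filter_upwards [hfin.compl_mem_cofinite] with i hi
  have hi' : |ψ i| ≤ M := not_lt.1 hi
  have h := hquad (t * ψ i) (by
    rw [abs_mul, abs_of_pos ht0]
    calc t * |ψ i| ≤ a / M * M := by gcongr; exact min_le_right _ _
      _ = a := by field_simp)
  rw [Real.norm_of_nonneg (sq_nonneg _), inv_mul_eq_div, le_div_iff₀ (by positivity)]
  linarith [h, mul_pow t (ψ i) 2, show c * (t * ψ i) ^ 2 = ψ i ^ 2 * (c * t ^ 2) by ring]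

/-- The law of `X - X'` with `X`, `X'` independent with law `μ`. -/
noncomputable def symmetrization (μ : Measure ℝ) : Measure ℝ :=
  μ ∗ μ.map ((-1 : ℝ) * ·)

instance (μ : Measure ℝ) [IsProbabilityMeasure μ] : IsProbabilityMeasure (symmetrization μ) := by
  have : IsProbabilityMeasure (μ.map ((-1 : ℝ) * ·)) :=
    Measure.isProbabilityMeasure_map (by fun_prop)
  unfold symmetrization
  infer_instance

lemma charFun_symmetrization (μ : Measure ℝ) [IsProbabilityMeasure μ] (t : ℝ) :
    charFun (symmetrization μ) t = ((‖charFun μ t‖ ^ 2 : ℝ) : ℂ) := by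
  rw [symmetrization, charFun_conv, charFun_map_mul, neg_one_mul, charFun_neg, Complex.mul_conj,
    Complex.normSq_eq_norm_sq]

lemma exists_ae_eq_const_of_symmetrization (μ : Measure ℝ) [IsProbabilityMeasure μ]
    (h : ∀ᵐ x ∂symmetrization μ, x = 0) : ∃ K : ℝ, ∀ᵐ x ∂μ, x = K := by
  have : IsProbabilityMeasure (μ.map ((-1 : ℝ) * ·)) :=
    Measure.isProbabilityMeasure_map (by fun_prop)
  have h1 : ∀ᵐ p ∂(μ.prod (μ.map ((-1 : ℝ) * ·))), p.1 + p.2 = 0 :=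
    ae_of_ae_map (by fun_prop) h
  -- Fubini: freezing one value `x` of the first variable forces the second to be constant.
  obtain ⟨x, hx⟩ := (Measure.ae_ae_of_ae_prod h1).exists
  refine ⟨x, ?_⟩
  filter_upwards [ae_of_ae_map (by fun_prop) hx] with y hy
  linarith

/-- The characteristic functions of an a.s. convergent sequence of random variables are eventually
bounded away from `0` on a common neighbourhood of the origin, pointwise in the argument. -/
lemma exists_eventually_half_le_norm_charFun {Ω : Type*} [MeasurableSpace Ω] (μ : Measure Ω)
    [IsProbabilityMeasure μ] {S : ℕ → Ω → ℝ} (hS : ∀ k, AEMeasurable (S k) μ)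
    (hconv : ∀ᵐ ω ∂μ, ∃ s, Tendsto (fun k => S k ω) atTop (nhds s)) :
    ∃ δ > 0, ∀ t : ℝ, |t| ≤ δ → ∀ᶠ k in atTop, 1 / 2 ≤ ‖charFun (μ.map (S k)) t‖ := by
  obtain ⟨L, hL, hlim⟩ := measurable_limit_of_tendsto_metrizable_ae hS hconv
  have : IsProbabilityMeasure (μ.map L) := Measure.isProbabilityMeasure_map hL.aemeasurable
  have hev : ∀ᶠ t in nhds (0 : ℝ), 1 / 2 < ‖charFun (μ.map L) t‖ := by
    refine (continuous_charFun (μ := μ.map L)).norm.continuousAt.eventually_const_lt ?_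
    simp; norm_num
  obtain ⟨δ, hδ, hball⟩ := Metric.eventually_nhds_iff.1 hev
  refine ⟨δ / 2, by positivity, fun t ht => ?_⟩
  have hint : ∀ f : Ω → ℝ, AEMeasurable f μ →
      charFun (μ.map f) t = ∫ ω, Complex.exp (t * f ω * Complex.I) ∂μ := fun f hf => by
    rw [charFun_apply_real, integral_map hf (by fun_prop)]
  have htend : Tendsto (fun k => charFun (μ.map (S k)) t) atTop (nhds (charFun (μ.map L) t)) := by
    simp only [hint _ (hS _), hint _ hL.aemeasurable]
    refine tendsto_integral_of_dominated_convergence (fun _ => 1)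
      (fun k => ?_) (integrable_const _) (fun k => ae_of_all _ fun ω => ?_) ?_
    · have := hS k
      exact AEMeasurable.aestronglyMeasurable (by fun_prop)
    · rw [← Complex.ofReal_mul, Complex.norm_exp_ofReal_mul_I]
    · filter_upwards [hlim] with ω hω
      have hc : Continuous fun x : ℝ => Complex.exp (t * x * Complex.I) := by fun_prop
      exact (hc.tendsto _).comp hω
  have hlt : 1 / 2 < ‖charFun (μ.map L) t‖ := hball (by rw [Real.dist_0_eq_abs]; linarith)
  exact (htend.norm.eventually_const_lt hlt).mono fun _ h => h.le

lemma sum_one_sub_le_of_quarter_le_prod {ι : Type*} (s : Finset ι) (x : ι → ℝ)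
    (hx : ∀ i ∈ s, 0 ≤ x i) (h : 1 / 4 ≤ ∏ i ∈ s, x i) : ∑ i ∈ s, (1 - x i) ≤ 3 := by
  have h1 : ∏ i ∈ s, x i ≤ Real.exp (-∑ i ∈ s, (1 - x i)) := by
    rw [← Finset.sum_neg_distrib, Real.exp_sum]
    refine Finset.prod_le_prod hx fun i _ => ?_
    linarith [Real.add_one_le_exp (-(1 - x i))]
  -- With `S` the sum, `S + 1 ≤ exp S ≤ 4`, whence the bound `3`.
  have h2 := Real.add_one_le_exp (∑ i ∈ s, (1 - x i))
  have h3 := Real.exp_pos (∑ i ∈ s, (1 - x i))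
  have h4 : 1 / 4 * Real.exp (∑ i ∈ s, (1 - x i)) ≤ 1 := by
    calc _ ≤ Real.exp (-∑ i ∈ s, (1 - x i)) * Real.exp (∑ i ∈ s, (1 - x i)) := by
          gcongr; exact h.trans h1
      _ = 1 := by rw [← Real.exp_add]; simp
  linarith

/-- If weighted sums of a nondegenerate i.i.d. family along an exhausting sequence of finite sets
converge almost surely, then the weights are square summable. -/
theorem summable_sq_of_ae_tendsto_sum {Ω ι : Type*} [MeasurableSpace Ω] (μ : Measure Ω)
    [IsProbabilityMeasure μ] (X : ι → Ω → ℝ) (ψ : ι → ℝ) (hmeas : ∀ i, Measurable (X i))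
    (hindep : iIndepFun X μ) (hident : ∀ i j, IdentDistrib (X i) (X j) μ μ)
    (hnondet : ¬ IsDeterministicField μ X) (F : ℕ → Finset ι) (hF : Tendsto F atTop atTop)
    (hconv : ∀ᵐ ω ∂μ, ∃ s, Tendsto (fun k => ∑ i ∈ F k, ψ i * X i ω) atTop (nhds s)) :
    Summable fun i => ψ i ^ 2 := by
  rcases isEmpty_or_nonempty ι with hι | ⟨⟨i₀⟩⟩
  · exact (hasSum_empty).summable
  set ν := μ.map (X i₀) with hν
  have : IsProbabilityMeasure ν := Measure.isProbabilityMeasure_map (hmeas i₀).aemeasurable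
  have hS : ∀ k, AEMeasurable (fun ω => ∑ i ∈ F k, ψ i * X i ω) μ := fun k => by fun_prop
  have hchar : ∀ k t, charFun (μ.map fun ω => ∑ i ∈ F k, ψ i * X i ω) t
      = ∏ i ∈ F k, charFun ν (t * ψ i) := by
    intro k t
    have hind : iIndepFun (fun i ω => ψ i * X i ω) μ :=
      hindep.comp (fun i x => ψ i * x) fun i => by fun_prop
    rw [(hind.restrict _).charFun_map_fun_finsetSum_eq_prod fun i _ => by fun_prop,
      Finset.prod_apply]
    refine Finset.prod_congr rfl fun i _ => ?_
    rw [charFun_map_mul_comp (hmeas i).aemeasurable, (hident i i₀).map_eq, mul_comm]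
  obtain ⟨δ, hδ, hhalf⟩ := exists_eventually_half_le_norm_charFun μ hS hconv
  refine summable_sq_of_sum_norm_one_sub_charFun_le (symmetrization ν) (fun h => hnondet ?_) ψ hδ
    (C := 3) fun t ht s => ?_
  · obtain ⟨K, hK⟩ := exists_ae_eq_const_of_symmetrization ν h
    refine ⟨K, fun i => ae_of_ae_map (p := fun x => x = K) (hmeas i).aemeasurable ?_⟩
    rwa [(hident i i₀).map_eq]
  have hle : ∀ u, ‖charFun ν u‖ ^ 2 ≤ 1 := fun u =>
    pow_le_one₀ (norm_nonneg _) (norm_charFun_le_one u)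
  have hnorm : ∀ u, ‖1 - charFun (symmetrization ν) u‖ = 1 - ‖charFun ν u‖ ^ 2 := fun u => by
    rw [charFun_symmetrization, ← Complex.ofReal_one, ← Complex.ofReal_sub, Complex.norm_real,
      Real.norm_of_nonneg (by linarith [hle u])]
  simp only [hnorm]
  obtain ⟨k, hk, hsk⟩ := ((hhalf t ht).and (hF.eventually_ge_atTop s)).exists
  calc ∑ i ∈ s, (1 - ‖charFun ν (t * ψ i)‖ ^ 2)
      ≤ ∑ i ∈ F k, (1 - ‖charFun ν (t * ψ i)‖ ^ 2) :=
        Finset.sum_le_sum_of_subset_of_nonneg hsk fun i _ _ => by linarith [hle (t * ψ i)]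
    _ ≤ 3 := by
        refine sum_one_sub_le_of_quarter_le_prod _ _ (fun _ _ => by positivity) ?_
        rw [hchar, norm_prod] at hk
        rw [Finset.prod_pow]
        calc (1 / 4 : ℝ) = (1 / 2) ^ 2 := by norm_num
          _ ≤ _ := by gcongr

theorem mainTheorem6 {Ω : Type*} [MeasurableSpace Ω] (μ : Measure Ω) [IsProbabilityMeasure μ]
    (d : ℕ) (X : (Fin d → ℕ) → Ω → ℝ) (ψ : (Fin d → ℕ) → ℝ)
    (hmeas : ∀ n, Measurable (X n))
    (hindep : iIndepFun X μ)
    (hident : ∀ n m, IdentDistrib (X n) (X m) μ μ)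
    (hnondet : ¬ IsDeterministicField μ X)
    (hsign : (∀ n, IsSymmetricRV μ (X n)) ∨ (∀ n, ∀ᵐ ω ∂μ, 0 ≤ X n ω))
    (hconv : ConvergesRectangularlyAS μ (fun n ω => ψ n * X n ω)) :
    Summable (fun n => ψ n ^ 2) := by
  refine summable_sq_of_ae_tendsto_sum μ X ψ hmeas hindep hident hnondet
    (fun k => Finset.Iic fun _ => k) ?_ ?_
  · refine tendsto_atTop_finset_of_monotone
      (fun k l hkl => Finset.Iic_subset_Iic.2 fun _ => hkl) fun n => ?_
    -- The coordinate sum dominates every coordinate, also when `d = 0`.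
    exact ⟨∑ i, n i, Finset.mem_Iic.2 fun i =>
      Finset.single_le_sum (f := n) (fun _ _ => Nat.zero_le _) (Finset.mem_univ i)⟩
  · filter_upwards [hconv] with ω ⟨s, hs⟩
    exact ⟨s, hs (fun k _ => k) fun _ => tendsto_id⟩
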